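/- Let $(X,d)$ be a nonempty locally compact separable metric space whose metric $d$ is the restriction to $X$ of some metric $\widetilde d$ on the one-point compactification $\widetilde X=X\cup\{\infty\}$ that induces the topology of $\widetilde X$. Let $f:X\to X$ be a proper map (continuous, with compact preimages of compact sets), and let $\varphi:X\to\mathbb R$ be a continuous function that extends continuously to $\widetilde X$. Write $(S_n\varphi)(x)=\sum_{i=0}^{n-1}\varphi(f^i x)$. The pressure is defined as follows. An admissible open set is an open subset of $X$ whose closure or whose complement is compact; an admissible cover $\mathcal U$ of $X$ is a finite cover by admissible open sets, and $|\mathcal U|$ is the largest diameter of its members. For a string $\mathbf U=(U_0,\dots,U_{m-1})$ of members of $\mathcal U$ put $m(\mathbf U)=m$ and $X(\mathbf U)=\{x\in X: f^j(x)\in U_j,\ 0\le j<m\}$. For $Z\subset X$, $\alpha\in\mathbb R$ and $N\in\mathbb N$ let $$M(Z,\alpha,\varphi,\mathcal U,N)=\inf_{\mathcal G}\sum_{\mathbf U\in\mathcal G}\exp\Big(-\alpha\, m(\mathbf U)+\sup_{x\in X(\mathbf U)}(S_{m(\mathbf U)}\varphi)(x)\Big),$$ the infimum being over all finite or countable collections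 $\mathcal G$ of strings with $m(\mathbf U)\ge N$ for all $\mathbf U\in\mathcal G$ and $Z\subset\bigcup_{\mathbf U\in\mathcal G}X(\mathbf U)$ (with $\sup\emptyset=-\infty$ and $\exp(-\infty)=0$). Let $m(Z,\alpha,\varphi,\mathcal U)=\lim_{N\to\infty}M(Z,\alpha,\varphi,\mathcal U,N)$, $$P_{Z,f}(\varphi,\mathcal U)=\inf\{\alpha\in\mathbb R: m(Z,\alpha,\varphi,\mathcal U)=0\}\in[-\infty,\infty],\qquad P_{Z,f}(\varphi)=\lim_{|\mathcal U|\to0}P_{Z,f}(\varphi,\mathcal U).$$ Then for every integer $k\ge 0$: admissible covers of arbitrarily small diameter exist, the limits defining $P_{X,f}(\varphi)$ and $P_{X,f^k}(S_k\varphi)$ exist in $[-\infty,\infty]$, and $$P_{X,f^k}(S_k\varphi)=k\,P_{X,f}(\varphi)$$ (with the convention $0\cdot\infty=0$ when $k=0$). -/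

import Mathlib

open Filter Topology
open scoped ENNReal

namespace AdmissiblePressure

section Covers

variable {X : Type*}

/-- An admissible open set: an open set whose closure or whose complement is compact. -/
def IsAdmissibleOpen [TopologicalSpace X] (U : Set X) : Prop :=
  IsOpen U ∧ (IsCompact (closure U) ∨ IsCompact Uᶜ)

/-- An admissible cover: a finite cover of the space by admissible open sets. -/
structure AdmissibleCover (X : Type*) [TopologicalSpace X] where
  sets : Finset (Set X)
  admissible : ∀ U ∈ sets, IsAdmissibleOpen U
  covers : ∀ x : X, ∃ U ∈ sets, x ∈ U

/-- The strings (finite words) whose letters are members of the cover. -/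
abbrev AdmissibleCover.Words [TopologicalSpace X] (𝒰 : AdmissibleCover X) : Type _ :=
  List {U : Set X // U ∈ 𝒰.sets}

/-- The diameter `|𝒰|` of a cover: the largest diameter of its members. -/
noncomputable def AdmissibleCover.diam [MetricSpace X] (𝒰 : AdmissibleCover X) : ℝ≥0∞ :=
  ⨆ U ∈ 𝒰.sets, Metric.ediam U

/-- The filter `|𝒰| → 0` on admissible covers. -/
noncomputable def vanishingDiam (X : Type*) [MetricSpace X] : Filter (AdmissibleCover X) :=
  comap AdmissibleCover.diam (𝓝 0)

end Covers

section Pressure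

variable {X : Type*}

/-- The set `X(𝐔) = {x | f^j x ∈ U_j for 0 ≤ j < m(𝐔)}` attached to a string `𝐔`. -/
def cylinder [TopologicalSpace X] (f : X → X) {𝒰 : AdmissibleCover X} (s : 𝒰.Words) : Set X :=
  {x | ∀ (j : ℕ) (hj : j < s.length), f^[j] x ∈ (s[j]).1}

/-- The quantity `exp (-α m(𝐔) + sup_{x ∈ X(𝐔)} (S_{m(𝐔)} φ)(x))`; it is `0` when `X(𝐔)` is
empty, since the supremum is then `-∞`. -/
noncomputable def weight [TopologicalSpace X] (f : X → X) (φ : X → ℝ) (α : ℝ)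
    {𝒰 : AdmissibleCover X} (s : 𝒰.Words) : ℝ≥0∞ :=
  EReal.exp (((-α * (s.length : ℝ) : ℝ) : EReal) +
    ⨆ x ∈ cylinder f s, ((birkhoffSum f φ s.length x : ℝ) : EReal))

/-- `M(Z, α, φ, 𝒰, N)`: the infimum of the total weight over the countable collections of strings
of length at least `N` that cover `Z`. -/
noncomputable def outerSum [TopologicalSpace X] (f : X → X) (φ : X → ℝ) (Z : Set X) (α : ℝ)
    (𝒰 : AdmissibleCover X) (N : ℕ) : ℝ≥0∞ :=
  ⨅ (G : Set 𝒰.Words) (_ : G.Countable) (_ : ∀ s ∈ G, N ≤ s.length)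
    (_ : Z ⊆ ⋃ s ∈ G, cylinder f s), ∑' s : G, weight f φ α s.1

/-- `m(Z, α, φ, 𝒰)`, the limit of `M(Z, α, φ, 𝒰, N)` as `N → ∞`; the sequence is nondecreasing,
so the limit is the supremum (see `tendsto_outerSum`). -/
noncomputable def outerLimit [TopologicalSpace X] (f : X → X) (φ : X → ℝ) (Z : Set X) (α : ℝ)
    (𝒰 : AdmissibleCover X) : ℝ≥0∞ :=
  ⨆ N : ℕ, outerSum f φ Z α 𝒰 N

theorem tendsto_outerSum [TopologicalSpace X] (f : X → X) (φ : X → ℝ) (Z : Set X) (α : ℝ)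
    (𝒰 : AdmissibleCover X) :
    Tendsto (outerSum f φ Z α 𝒰) atTop (𝓝 (outerLimit f φ Z α 𝒰)) := by
  refine tendsto_atTop_iSup fun M N h => ?_
  refine le_iInf fun G => le_iInf fun hG => le_iInf fun hl => le_iInf fun hc => ?_
  exact iInf_le_of_le G (iInf_le_of_le hG (iInf_le_of_le (fun s hs => h.trans (hl s hs))
    (iInf_le_of_le hc le_rfl)))

/-- `P_Z(φ, 𝒰) = inf {α ∈ ℝ | m(Z, α, φ, 𝒰) = 0}`, an extended real number. -/
noncomputable def coverPressure [TopologicalSpace X] (f : X → X) (φ : X → ℝ) (Z : Set X)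
    (𝒰 : AdmissibleCover X) : EReal :=
  sInf ((fun α : ℝ => (α : EReal)) '' {α : ℝ | outerLimit f φ Z α 𝒰 = 0})

/-- The topological pressure `P_{Z,f}(φ) = lim_{|𝒰| → 0} P_Z(φ, 𝒰)`. -/
noncomputable def pressure [MetricSpace X] (f : X → X) (φ : X → ℝ) (Z : Set X) : EReal :=
  limUnder (vanishingDiam X) (coverPressure f φ Z)

end Pressure

/-- The metric of `X` is the restriction to `X` of some metric on the one-point compactification
`OnePoint X` that induces the topology of `OnePoint X`. -/
def IsRestrictedFromOnePoint (X : Type*) [MetricSpace X] : Prop :=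
  ∃ m : MetricSpace (OnePoint X),
    m.toUniformSpace.toTopologicalSpace = (OnePoint.instTopologicalSpace : TopologicalSpace (OnePoint X)) ∧
    ∀ x y : X, m.dist (x : OnePoint X) (y : OnePoint X) = dist x y

end AdmissiblePressure

/-! On a cover of small diameter `φ` oscillates by at most `ε`, since `φ` is uniformly continuous by
compactness of `OnePoint X`. Hence the choice of point in a cylinder changes a Birkhoff sum by at
most `ε` per letter, and such an error is absorbed by shifting `α`.

Existence of the limits: by a Lebesgue number on the compactification, every sufficiently fine cover
`𝒱` refines a given `𝒰`, and then the pressure along `𝒰` exceeds that along `𝒱` by at most `ε`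
(`coverPressure_le_of_refines`). This is a one-sided Cauchy condition.

The formula for `k > 0`: compare `𝒰` under `f` with its cover by cylinders of length `k` under
`f^[k]`. Concatenating blocks (`coverPressure_le_iterate`) and cutting words into blocks
(`coverPressure_iterate_le`) show that the second pressure is `k` times the first up to `k * ε`. The
cylinder covers also have vanishing diameter, so both sides pass to the limit. For `k = 0` the
pressure of the identity with zero potential vanishes for every cover. -/

namespace AdmissiblePressure

/-! ### Limits of extended reals -/

section ExtendedReal

theorem _root_.EReal.le_of_forall_pos_real_le_add {a b : EReal}
    (h : ∀ ε : ℝ, 0 < ε → a ≤ b + (ε : EReal)) : a ≤ b := by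
  induction b using EReal.rec with
  | bot => simpa using h 1 one_pos
  | top => exact le_top
  | coe b =>
    refine EReal.le_of_forall_lt_iff_le.1 fun z hz => ?_
    have hz' : b < z := by exact_mod_cast hz
    refine (h (z - b) (sub_pos.2 hz')).trans (le_of_eq ?_)
    rw [← EReal.coe_add]
    simp

theorem _root_.EReal.continuous_const_mul_add_const {c : ℝ} (hc : 0 < c) (e : ℝ) :
    Continuous fun x : EReal => (c : EReal) * x + (e : EReal) := by
  have hc' : (c : EReal) ≠ 0 := by exact_mod_cast hc.ne'
  refine continuous_iff_continuousAt.2 fun x => ?_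
  have hmul : ContinuousAt (fun x : EReal => (c : EReal) * x) x :=
    (EReal.continuousAt_mul (p := ((c : EReal), x)) (Or.inl hc') (Or.inl hc')
      (Or.inl (EReal.coe_ne_bot c)) (Or.inl (EReal.coe_ne_top c))).comp
      (continuousAt_const.prodMk continuousAt_id)
  exact ContinuousAt.comp (f := fun x : EReal => ((c : EReal) * x, (e : EReal)))
    (EReal.continuousAt_add (p := ((c : EReal) * x, (e : EReal))) (Or.inr (EReal.coe_ne_bot e))
      (Or.inr (EReal.coe_ne_top e))) (hmul.prodMk continuousAt_const)

/-- If liminf < limsup, put reals `a < b` strictly between them: values below `a` recur, so the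
hypothesis with `ε = b - a` eventually bounds `u` by `b`, a contradiction. -/
theorem exists_tendsto_of_eventually_le_add {ι : Type*} {l : Filter ι} {u : ι → EReal}
    (h : ∀ ε : ℝ, 0 < ε → ∀ᶠ i in l, ∀ᶠ j in l, u i ≤ u j + (ε : EReal)) :
    ∃ a, Tendsto u l (𝓝 a) := by
  refine ⟨liminf u l, tendsto_of_le_liminf_of_limsup_le le_rfl (le_of_not_gt fun hlt => ?_)⟩
  obtain ⟨a, ha, ha'⟩ := EReal.lt_iff_exists_real_btwn.1 hlt
  obtain ⟨b, hab, hb⟩ := EReal.lt_iff_exists_real_btwn.1 ha'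
  have hab' : a < b := by exact_mod_cast hab
  have hfreq : ∃ᶠ j in l, u j < a := frequently_lt_of_liminf_lt (by isBoundedDefault) ha
  refine absurd hb (not_lt.2 (limsup_le_of_le (by isBoundedDefault) ?_))
  filter_upwards [h (b - a) (sub_pos.2 hab')] with i hi
  obtain ⟨j, hj, hij⟩ := (hfreq.and_eventually hi).exists
  refine hij.trans ((add_le_add hj.le le_rfl).trans (le_of_eq ?_))
  rw [← EReal.coe_add]
  simp

end ExtendedReal

/-! ### Transporting covering collections along a map of words -/

section Comparison

variable {X : Type*} [TopologicalSpace X]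

/-- The values of `φ` on each member of the cover differ by at most `ε`. -/
def HasOscLE (φ : X → ℝ) (𝒰 : AdmissibleCover X) (ε : ℝ) : Prop :=
  ∀ U ∈ 𝒰.sets, ∀ x ∈ U, ∀ y ∈ U, φ y ≤ φ x + ε

theorem HasOscLE.birkhoffSum_le {f : X → X} {φ : X → ℝ} {𝒰 : AdmissibleCover X} {ε : ℝ}
    (h : HasOscLE φ 𝒰 ε) {s : 𝒰.Words} {x y : X} (hx : x ∈ cylinder f s) (hy : y ∈ cylinder f s)
    {n : ℕ} (hn : n ≤ s.length) :
    birkhoffSum f φ n y ≤ birkhoffSum f φ n x + n * ε := by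
  have : birkhoffSum f φ n x + n * ε = ∑ j ∈ Finset.range n, (φ (f^[j] x) + ε) := by
    simp [birkhoffSum, Finset.sum_add_distrib]
  rw [this]
  refine Finset.sum_le_sum fun j hj => ?_
  have hj' : j < s.length := (Finset.mem_range.1 hj).trans_le hn
  exact h _ (s[j]).2 _ (hx j hj') _ (hy j hj')

theorem weight_le {f g : X → X} {φ ψ : X → ℝ} {α β c D : ℝ} {𝒰 𝒱 : AdmissibleCover X}
    {s : 𝒰.Words} {t : 𝒱.Words} {x : X} (hx : x ∈ cylinder f s)
    (h : ∀ y ∈ cylinder g t, birkhoffSum g ψ t.length y ≤ birkhoffSum f φ s.length x + D)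
    (hD : -β * t.length + D ≤ -α * s.length + c) :
    weight g ψ β t ≤ ENNReal.ofReal (Real.exp c) * weight f φ α s := by
  unfold weight
  rw [← EReal.exp_coe, ← EReal.exp_add]
  refine EReal.exp_monotone ?_
  calc
    _ ≤ ((-β * t.length : ℝ) : EReal) + ((birkhoffSum f φ s.length x + D : ℝ) : EReal) :=
      add_le_add le_rfl (iSup₂_le fun y hy => EReal.coe_le_coe_iff.2 (h y hy))
    _ ≤ (c : EReal) + (((-α * s.length : ℝ) : EReal) + ((birkhoffSum f φ s.length x : ℝ) : EReal)) := by
      rw [← EReal.coe_add, ← EReal.coe_add, ← EReal.coe_add, EReal.coe_le_coe_iff]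
      linarith
    _ ≤ _ := by
      gcongr
      exact le_iSup₂ (f := fun y (_ : y ∈ cylinder f s) => ((birkhoffSum f φ s.length y : ℝ) : EReal))
        x hx

theorem outerSum_le_mul {f g : X → X} {φ ψ : X → ℝ} {Z : Set X} {α β : ℝ}
    {𝒰 𝒱 : AdmissibleCover X} {N N' : ℕ} {C : ℝ≥0∞} (hC₀ : C ≠ 0) (hC : C ≠ ⊤)
    (T : 𝒰.Words → 𝒱.Words) (hlen : ∀ s : 𝒰.Words, N ≤ s.length → N' ≤ (T s).length)
    (hcyl : ∀ s : 𝒰.Words, cylinder f s ⊆ cylinder g (T s))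
    (hw : ∀ s : 𝒰.Words, (cylinder f s).Nonempty → weight g ψ β (T s) ≤ C * weight f φ α s) :
    outerSum g ψ Z β 𝒱 N' ≤ C * outerSum f φ Z α 𝒰 N := by
  unfold outerSum
  simp only [ENNReal.mul_iInf_of_ne hC₀ hC]
  refine le_iInf fun G => le_iInf fun hG => le_iInf fun hN => le_iInf fun hZ => ?_
  -- A word with empty cylinder weighs `0`, but its image under `T` may have positive weight, so
  -- such words are dropped first.
  let G' : Set 𝒰.Words := {s ∈ G | (cylinder f s).Nonempty}
  have hsub : G' ⊆ G := Set.sep_subset _ _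
  refine iInf_le_of_le (T '' G') (iInf_le_of_le ((hG.mono hsub).image T)
    (iInf_le_of_le ?_ (iInf_le_of_le ?_ ?_)))
  · rintro _ ⟨s, hs, rfl⟩
    exact hlen s (hN s hs.1)
  · intro x hx
    obtain ⟨s, hs, hxs⟩ := Set.mem_iUnion₂.1 (hZ hx)
    exact Set.mem_iUnion₂.2 ⟨T s, ⟨s, ⟨hs, x, hxs⟩, rfl⟩, hcyl s hxs⟩
  · calc
      ∑' t : T '' G', weight g ψ β t.1
          ≤ ∑' s : G', weight g ψ β (Set.imageFactorization T G' s).1 :=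
        ENNReal.tsum_le_tsum_comp_of_surjective Set.imageFactorization_surjective
          (fun t : T '' G' => weight g ψ β t.1)
      _ ≤ ∑' s : G', C * weight f φ α s.1 := ENNReal.tsum_le_tsum fun s => hw s.1 s.2.2
      _ ≤ ∑' s : G, C * weight f φ α s.1 :=
        ENNReal.tsum_mono_subtype (fun s => C * weight f φ α s) hsub
      _ = C * ∑' s : G, weight f φ α s.1 := ENNReal.tsum_mul_left

/-- The constant `c` is uniform over all words, so weights change at most by the factor `exp c`,
which cannot affect vanishing. Bounded errors are therefore free; only errors growing with the
length force `β` to differ from `α`. -/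
theorem outerLimit_eq_zero {f g : X → X} {φ ψ : X → ℝ} {Z : Set X} {α β c : ℝ}
    {𝒰 𝒱 : AdmissibleCover X} (T : 𝒰.Words → 𝒱.Words)
    (hlen : ∀ N' : ℕ, ∃ N, ∀ s : 𝒰.Words, N ≤ s.length → N' ≤ (T s).length)
    (hcyl : ∀ s : 𝒰.Words, cylinder f s ⊆ cylinder g (T s))
    (hw : ∀ s : 𝒰.Words, ∀ x ∈ cylinder f s, ∃ D : ℝ,
      (∀ y ∈ cylinder g (T s),
        birkhoffSum g ψ (T s).length y ≤ birkhoffSum f φ s.length x + D) ∧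
      -β * (T s).length + D ≤ -α * s.length + c)
    (h : outerLimit f φ Z α 𝒰 = 0) : outerLimit g ψ Z β 𝒱 = 0 := by
  refine le_antisymm (iSup_le fun N' => ?_) zero_le
  obtain ⟨N, hN⟩ := hlen N'
  have h0 : outerSum f φ Z α 𝒰 N = 0 :=
    le_antisymm ((le_iSup (outerSum f φ Z α 𝒰) N).trans h.le) zero_le
  refine (outerSum_le_mul (C := ENNReal.ofReal (Real.exp c)) (N := N) (α := α) (φ := φ)
    (by simp [Real.exp_pos]) ENNReal.ofReal_ne_top T hN hcyl
    fun s ⟨x, hx⟩ => ?_).trans (by rw [h0, mul_zero])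
  obtain ⟨D, hD, hD'⟩ := hw s x hx
  exact weight_le hx hD hD'

theorem coverPressure_le_mul_add {f g : X → X} {φ ψ : X → ℝ} {Z : Set X} {𝒰 𝒱 : AdmissibleCover X}
    {c e : ℝ} (hc : 0 < c)
    (h : ∀ α : ℝ, outerLimit f φ Z α 𝒰 = 0 → outerLimit g ψ Z (c * α + e) 𝒱 = 0) :
    coverPressure g ψ Z 𝒱 ≤ (c : EReal) * coverPressure f φ Z 𝒰 + (e : EReal) := by
  have hc' : (0 : EReal) < c := by exact_mod_cast hc
  have he : (e : EReal) ≠ ⊥ ∨ (c : EReal) * coverPressure f φ Z 𝒰 ≠ ⊤ := Or.inl (EReal.coe_ne_bot e)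
  have he' : (e : EReal) ≠ ⊤ ∨ (c : EReal) * coverPressure f φ Z 𝒰 ≠ ⊥ := Or.inl (EReal.coe_ne_top e)
  rw [← EReal.sub_le_iff_le_add he he', ← EReal.div_le_iff_le_mul hc' (EReal.coe_ne_top c)]
  refine le_sInf ?_
  rintro _ ⟨α, hα, rfl⟩
  rw [EReal.div_le_iff_le_mul hc' (EReal.coe_ne_top c),
    EReal.sub_le_iff_le_add (Or.inl (EReal.coe_ne_bot e)) (Or.inl (EReal.coe_ne_top e))]
  refine sInf_le ⟨c * α + e, h α hα, ?_⟩
  simp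

end Comparison

/-! ### Monotonicity under refinement -/

section Refinement

variable {X : Type*} [TopologicalSpace X]

/-- Replacing each letter by a member of `𝒰` containing it enlarges the cylinder, which raises the
supremum of the Birkhoff sum by at most `ε` per letter. -/
theorem coverPressure_le_of_refines {f : X → X} {φ : X → ℝ} {Z : Set X} {𝒰 𝒱 : AdmissibleCover X}
    {ε : ℝ} (hφ : HasOscLE φ 𝒰 ε) (h : ∀ V ∈ 𝒱.sets, ∃ U ∈ 𝒰.sets, V ⊆ U) :
    coverPressure f φ Z 𝒰 ≤ coverPressure f φ Z 𝒱 + (ε : EReal) := by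
  choose! r hr hsub using h
  let T : 𝒱.Words → 𝒰.Words := List.map fun V => ⟨r V.1, hr V.1 V.2⟩
  have hlen : ∀ s : 𝒱.Words, (T s).length = s.length := fun s => List.length_map _
  have hcyl : ∀ s : 𝒱.Words, cylinder f s ⊆ cylinder f (T s) := fun s x hx j hj => by
    have hj' : j < s.length := by rwa [hlen] at hj
    simpa [T] using hsub _ (s[j]).2 (hx j hj')
  have key := coverPressure_le_mul_add (f := f) (g := f) (φ := φ) (ψ := φ) (Z := Z) (𝒰 := 𝒱)
    (𝒱 := 𝒰) (e := ε) one_pos fun α => outerLimit_eq_zero (c := 0) T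
      (fun N => ⟨N, fun s hs => by rwa [hlen]⟩) hcyl fun s x hx => ⟨s.length * ε, fun y hy => ?_, ?_⟩
  · simpa using key
  · have := hφ.birkhoffSum_le (hcyl s hx) hy le_rfl
    simpa only [hlen] using this
  · rw [hlen]
    linarith

end Refinement

/-! ### Cylinder covers and iterates -/

section Iterate

variable {X : Type*}

theorem birkhoffSum_iterate {M : Type*} [AddCommMonoid M] (f : X → X) (φ : X → M) (k m : ℕ) (x : X) :
    birkhoffSum f^[k] (birkhoffSum f φ k) m x = birkhoffSum f φ (k * m) x := by
  induction m with
  | zero => simp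
  | succ m ih => rw [birkhoffSum_succ, ih, Nat.mul_succ, birkhoffSum_add, Function.iterate_mul]

variable [TopologicalSpace X]

theorem IsAdmissibleOpen.inter {U V : Set X} (hU : IsAdmissibleOpen U) (hV : IsAdmissibleOpen V) :
    IsAdmissibleOpen (U ∩ V) := by
  refine ⟨hU.1.inter hV.1, ?_⟩
  rcases hU.2 with h | h
  · exact Or.inl (h.of_isClosed_subset isClosed_closure (closure_mono Set.inter_subset_left))
  rcases hV.2 with h' | h'
  · exact Or.inl (h'.of_isClosed_subset isClosed_closure (closure_mono Set.inter_subset_right))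
  · exact Or.inr (by rw [Set.compl_inter]; exact h.union h')

theorem IsAdmissibleOpen.preimage {f : X → X} (hf : Continuous f)
    (hproper : ∀ K : Set X, IsCompact K → IsCompact (f ⁻¹' K)) {U : Set X}
    (hU : IsAdmissibleOpen U) : IsAdmissibleOpen (f ⁻¹' U) :=
  ⟨hU.1.preimage hf, hU.2.imp
    (fun h => (hproper _ h).of_isClosed_subset isClosed_closure (hf.closure_preimage_subset U))
    fun h => by simpa using hproper _ h⟩

theorem isAdmissibleOpen_univ : IsAdmissibleOpen (Set.univ : Set X) :=
  ⟨isOpen_univ, Or.inr (by simp)⟩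

@[simp]
theorem cylinder_nil (f : X → X) {𝒰 : AdmissibleCover X} :
    cylinder f ([] : 𝒰.Words) = Set.univ := by
  ext x
  simp [cylinder]

theorem cylinder_cons (f : X → X) {𝒰 : AdmissibleCover X} (U : {U : Set X // U ∈ 𝒰.sets})
    (s : 𝒰.Words) : cylinder f (U :: s) = U.1 ∩ f ⁻¹' cylinder f s := by
  ext x
  constructor
  · intro h
    exact ⟨h 0 (by simp), fun j hj => h (j + 1) (by simpa using hj)⟩
  · rintro ⟨h₀, h⟩ (_ | j) hj
    · exact h₀
    · exact h j (by simpa using hj)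

theorem cylinder_append (f : X → X) {𝒰 : AdmissibleCover X} (s t : 𝒰.Words) :
    cylinder f (s ++ t) = cylinder f s ∩ f^[s.length] ⁻¹' cylinder f t := by
  induction s with
  | nil => simp
  | cons U s ih =>
    rw [List.cons_append, cylinder_cons, ih, cylinder_cons, List.length_cons,
      Function.iterate_succ, Set.preimage_comp, Set.preimage_inter, Set.inter_assoc]

theorem isAdmissibleOpen_cylinder {f : X → X} (hf : Continuous f)
    (hproper : ∀ K : Set X, IsCompact K → IsCompact (f ⁻¹' K)) {𝒰 : AdmissibleCover X}
    (s : 𝒰.Words) : IsAdmissibleOpen (cylinder f s) := by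
  induction s with
  | nil => simpa using isAdmissibleOpen_univ
  | cons U s ih =>
    rw [cylinder_cons]
    exact (𝒰.admissible U.1 U.2).inter (ih.preimage hf hproper)

open Classical in
/-- The cover by the cylinders of length `k`. -/
noncomputable def AdmissibleCover.cylinderCover (𝒰 : AdmissibleCover X) {f : X → X}
    (hf : Continuous f) (hproper : ∀ K : Set X, IsCompact K → IsCompact (f ⁻¹' K)) (k : ℕ) :
    AdmissibleCover X where
  sets := Finset.univ.image fun v : Fin k → {U : Set X // U ∈ 𝒰.sets} => cylinder f (List.ofFn v)
  admissible := by
    simp only [Finset.mem_image, Finset.mem_univ, true_and, forall_exists_index,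
      forall_apply_eq_imp_iff]
    exact fun v => isAdmissibleOpen_cylinder hf hproper _
  covers x := by
    choose U hU hxU using 𝒰.covers
    refine ⟨_, Finset.mem_image_of_mem _ (Finset.mem_univ fun j : Fin k =>
      ⟨U (f^[j] x), hU _⟩), fun j hj => ?_⟩
    simpa using hxU (f^[j] x)

variable {f : X → X} (hf : Continuous f)
  (hproper : ∀ K : Set X, IsCompact K → IsCompact (f ⁻¹' K)) {𝒰 : AdmissibleCover X} {k : ℕ}

theorem AdmissibleCover.mem_cylinderCover {W : Set X} :
    W ∈ (𝒰.cylinderCover hf hproper k).sets ↔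
      ∃ v : Fin k → {U : Set X // U ∈ 𝒰.sets}, cylinder f (List.ofFn v) = W := by
  simp [AdmissibleCover.cylinderCover]

theorem HasOscLE.cylinderCover {φ : X → ℝ} {ε : ℝ} (h : HasOscLE φ 𝒰 ε) :
    HasOscLE (birkhoffSum f φ k) (𝒰.cylinderCover hf hproper k) (k * ε) := by
  intro W hW x hx y hy
  obtain ⟨v, rfl⟩ := (AdmissibleCover.mem_cylinderCover hf hproper).1 hW
  exact h.birkhoffSum_le hx hy (by simp)

/-- Each letter of the cylinder cover is spelled out as a word of length `k`, and the words are
concatenated; the cylinder set is unchanged. -/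
theorem coverPressure_le_iterate {φ : X → ℝ} {Z : Set X} {ε : ℝ} (hφ : HasOscLE φ 𝒰 ε)
    (hk : 0 < k) :
    coverPressure f φ Z 𝒰 ≤ (((k : ℝ)⁻¹ : ℝ) : EReal) *
      coverPressure f^[k] (birkhoffSum f φ k) Z (𝒰.cylinderCover hf hproper k) + (ε : EReal) := by
  have hk' : (0 : ℝ) < k := by exact_mod_cast hk
  choose r hr using fun W : {W : Set X // W ∈ (𝒰.cylinderCover hf hproper k).sets} =>
    (AdmissibleCover.mem_cylinderCover hf hproper).1 W.2
  let T : (𝒰.cylinderCover hf hproper k).Words → 𝒰.Words := fun s =>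
    s.flatMap fun W => List.ofFn (r W)
  have hlen : ∀ s, (T s).length = k * s.length := fun s => by
    simp [T, List.length_flatMap, mul_comm]
  have hcyl : ∀ s, cylinder f (T s) = cylinder f^[k] s := fun s => by
    induction s with
    | nil => simp [T]
    | cons W s ih =>
      have : T (W :: s) = List.ofFn (r W) ++ T s := rfl
      rw [this, cylinder_append, ih, cylinder_cons, hr, List.length_ofFn]
  refine coverPressure_le_mul_add (inv_pos.2 hk') fun α => outerLimit_eq_zero (c := 0) T
    (fun N => ⟨N, fun s hs => ?_⟩) (fun s => (hcyl s).ge)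
    fun s x hx => ⟨s.length * (k * ε), fun y hy => ?_, ?_⟩
  · rw [hlen]
    exact hs.trans (Nat.le_mul_of_pos_left _ hk)
  · rw [hlen, ← birkhoffSum_iterate]
    rw [hcyl] at hy
    exact (hφ.cylinderCover hf hproper).birkhoffSum_le hx hy le_rfl
  · rw [hlen]
    push_cast
    field_simp
    linarith

/-- A word is cut into blocks of length `k` and the incomplete last block is discarded. Boundedness
of `φ` makes the cost of discarding it independent of the word. -/
theorem coverPressure_iterate_le {φ : X → ℝ} {Z : Set X} {ε B : ℝ} (hφ : HasOscLE φ 𝒰 ε)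
    (hB : ∀ x, |φ x| ≤ B) (hB₀ : 0 ≤ B) (hk : 0 < k) :
    coverPressure f^[k] (birkhoffSum f φ k) Z (𝒰.cylinderCover hf hproper k) ≤
      ((k : ℝ) : EReal) * coverPressure f φ Z 𝒰 + ((k * ε : ℝ) : EReal) := by
  have hk' : (0 : ℝ) < k := by exact_mod_cast hk
  have hidx : ∀ (s : 𝒰.Words) (i : Fin (s.length / k)) (j : Fin k), k * i + j < s.length :=
    fun s i j => by
      have h₁ : k * (i + 1) ≤ k * (s.length / k) := Nat.mul_le_mul_left k i.2
      have h₂ := Nat.mul_div_le s.length k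
      have h₃ := j.2
      rw [Nat.mul_succ] at h₁
      omega
  let T : 𝒰.Words → (𝒰.cylinderCover hf hproper k).Words := fun s =>
    List.ofFn fun i : Fin (s.length / k) =>
      ⟨cylinder f (List.ofFn fun j : Fin k => s[k * i + j]'(hidx s i j)),
        (AdmissibleCover.mem_cylinderCover hf hproper).2 ⟨_, rfl⟩⟩
  have hlen : ∀ s, (T s).length = s.length / k := fun s => List.length_ofFn
  have hcyl : ∀ s, cylinder f s ⊆ cylinder f^[k] (T s) := fun s x hx i hi => by
    have hi' : i < s.length / k := by rwa [hlen] at hi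
    simp only [T, List.getElem_ofFn]
    intro j hj
    have hj' : j < k := by simpa using hj
    have hit : (f^[k])^[i] x = f^[k * i] x := by rw [Function.iterate_mul]
    have hmem := hx _ (hidx s ⟨i, hi'⟩ ⟨j, hj'⟩)
    rw [List.getElem_ofFn, hit, ← Function.iterate_add_apply]
    simpa only [Nat.add_comm j] using hmem
  -- Fewer than `k` letters are lost: they change the Birkhoff sum by at most `k * B` and the term
  -- `α * s.length` by at most `k * |α|`.
  refine coverPressure_le_mul_add hk' fun α => outerLimit_eq_zero (c := k * B + k * |α|) T
    (fun N => ⟨k * N, fun s hs => ?_⟩) hcyl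
    fun s x hx => ⟨(s.length / k : ℕ) * (k * ε) + k * B, fun y hy => ?_, ?_⟩
  · rw [hlen]
    exact (Nat.le_div_iff_mul_le hk).2 (by rwa [mul_comm])
  · have h₁ := (hφ.cylinderCover hf hproper).birkhoffSum_le (hcyl s hx) hy le_rfl
    rw [hlen] at h₁ ⊢
    have h₂ : birkhoffSum f φ s.length x = birkhoffSum f φ (k * (s.length / k)) x +
        birkhoffSum f φ (s.length % k) (f^[k * (s.length / k)] x) := by
      rw [← birkhoffSum_add, Nat.div_add_mod]
    have h₃ : -(k * B) ≤ birkhoffSum f φ (s.length % k) (f^[k * (s.length / k)] x) := by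
      have h₄ : |birkhoffSum f φ (s.length % k) (f^[k * (s.length / k)] x)| ≤
          (s.length % k : ℕ) * B := by
        refine (Finset.abs_sum_le_sum_abs _ _).trans ((Finset.sum_le_card_nsmul _ _ B
          fun j _ => hB _).trans (by simp))
      have h₅ : ((s.length % k : ℕ) : ℝ) ≤ k := by exact_mod_cast (Nat.mod_lt _ hk).le
      have h₆ := mul_le_mul_of_nonneg_right h₅ hB₀
      linarith [neg_abs_le (birkhoffSum f φ (s.length % k) (f^[k * (s.length / k)] x))]
    rw [birkhoffSum_iterate f φ k _ x] at h₁
    linarith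
  · rw [hlen]
    have h₁ : (s.length : ℝ) = k * (s.length / k : ℕ) + (s.length % k : ℕ) := by
      exact_mod_cast (Nat.div_add_mod s.length k).symm
    have h₂ : ((s.length % k : ℕ) : ℝ) ≤ k := by exact_mod_cast (Nat.mod_lt _ hk).le
    have h₃ : α * (s.length % k : ℕ) ≤ k * |α| :=
      (mul_le_mul_of_nonneg_right (le_abs_self α) (Nat.cast_nonneg _)).trans
        (by rw [mul_comm]; exact mul_le_mul_of_nonneg_right h₂ (abs_nonneg α))
    rw [h₁]
    linarith

end Iterate

/-! ### Covers of small diameter and the compactification -/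

section Metric

universe u

variable {X : Type*} [MetricSpace X]

/-- Moving the metric to a separate type `Y` keeps its topology from clashing with the instance on
`OnePoint X`. -/
theorem IsRestrictedFromOnePoint.exists_homeomorph {X : Type u} [MetricSpace X]
    (hd : IsRestrictedFromOnePoint X) :
    ∃ (Y : Type u) (_ : MetricSpace Y) (e : OnePoint X ≃ₜ Y), Isometry fun x : X => e x := by
  obtain ⟨m, hm, hdist⟩ := hd
  exact ⟨OnePoint X, m, @Homeomorph.mk _ _ _ m.toUniformSpace.toTopologicalSpace (Equiv.refl _)
    (by rw [hm]; exact continuous_id) (by rw [hm]; exact continuous_id), Isometry.of_dist_eq hdist⟩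

/-- Admissible sets extend to open sets of the compactification, with `∞` added exactly when the
complement is compact; the extensions still cover. -/
theorem IsRestrictedFromOnePoint.exists_lebesgueNumber [Nonempty X]
    (hd : IsRestrictedFromOnePoint X) (𝒰 : AdmissibleCover X) :
    ∃ δ > 0, ∀ V : Set X, Metric.ediam V < δ → ∃ U ∈ 𝒰.sets, V ⊆ U := by
  classical
  obtain ⟨Y, _, e, he⟩ := hd.exists_homeomorph
  have := e.compactSpace
  let O : {U : Set X // U ∈ 𝒰.sets} → Set (OnePoint X) := fun U =>
    if IsCompact U.1ᶜ then ((↑) '' U.1ᶜ)ᶜ else (↑) '' U.1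
  have hO : ∀ U, IsOpen (O U) := fun U => by
    have hU := (𝒰.admissible U.1 U.2).1
    by_cases h : IsCompact U.1ᶜ
    · simpa [O, h] using OnePoint.isOpen_compl_image_coe.2 ⟨hU.isClosed_compl, h⟩
    · simpa [O, h] using OnePoint.isOpen_image_coe.2 hU
  have hpre : ∀ (U : {U : Set X // U ∈ 𝒰.sets}) (x : X), (x : OnePoint X) ∈ O U ↔ x ∈ U.1 :=
    fun U x => by by_cases h : IsCompact U.1ᶜ <;> simp [O, h]
  have hcov : (Set.univ : Set (OnePoint X)) ⊆ ⋃ U, O U := by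
    intro p _
    induction p using OnePoint.rec with
    | coe x =>
      obtain ⟨U, hU, hx⟩ := 𝒰.covers x
      exact Set.mem_iUnion.2 ⟨⟨U, hU⟩, (hpre _ x).2 hx⟩
    | infty =>
      -- If `∞` were missed, all closures would be compact, hence so would `X`; then every member
      -- has compact complement after all.
      by_contra hinf
      have hnot : ∀ U ∈ 𝒰.sets, ¬ IsCompact Uᶜ := fun U hU h =>
        hinf (Set.mem_iUnion.2 ⟨⟨U, hU⟩, by simp [O, h]⟩)
      have huniv : IsCompact (Set.univ : Set X) :=
        (𝒰.sets.isCompact_biUnion fun U hU =>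
          (𝒰.admissible U hU).2.resolve_right (hnot U hU)).of_isClosed_subset isClosed_univ
          fun x _ => by
            obtain ⟨U, hU, hx⟩ := 𝒰.covers x
            exact Set.mem_iUnion₂.2 ⟨U, hU, subset_closure hx⟩
      obtain ⟨U, hU, -⟩ := 𝒰.covers (Classical.arbitrary X)
      exact hnot U hU (huniv.of_isClosed_subset (𝒰.admissible U hU).1.isClosed_compl
        (Set.subset_univ _))
  obtain ⟨δ, hδ, h⟩ := lebesgue_number_lemma_of_emetric
    (isCompact_univ : IsCompact (Set.univ : Set Y)) (c := fun U => e.symm ⁻¹' O U)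
    (fun U => (hO U).preimage e.symm.continuous) fun p _ => by
      simpa using hcov (Set.mem_univ (e.symm p))
  refine ⟨δ, hδ, fun V hV => ?_⟩
  rcases V.eq_empty_or_nonempty with rfl | ⟨x, hx⟩
  · obtain ⟨U, hU, -⟩ := 𝒰.covers (Classical.arbitrary X)
    exact ⟨U, hU, Set.empty_subset U⟩
  · obtain ⟨U, hU⟩ := h (e x) (Set.mem_univ _)
    refine ⟨U.1, U.2, fun y hy => (hpre U y).1 ?_⟩
    have hmem : e y ∈ Metric.eball (e x) δ := by
      rw [Metric.mem_eball, he.edist_eq]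
      exact (Metric.edist_le_ediam_of_mem hy hx).trans_lt hV
    simpa using hU hmem

theorem IsRestrictedFromOnePoint.uniformContinuous (hd : IsRestrictedFromOnePoint X) {φ : X → ℝ}
    (hφ : ∃ φ' : C(OnePoint X, ℝ), ∀ x : X, φ' (x : OnePoint X) = φ x) : UniformContinuous φ := by
  obtain ⟨Y, _, e, he⟩ := hd.exists_homeomorph
  have := e.compactSpace
  obtain ⟨φ', hφ'⟩ := hφ
  have hcomp : φ = (φ' ∘ e.symm) ∘ fun x : X => e x := funext fun x => by simp [hφ']
  rw [hcomp]
  exact (CompactSpace.uniformContinuous_of_continuous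
    (φ'.continuous.comp e.symm.continuous)).comp he.uniformContinuous

/-- The trace of a small ball about `∞` has compact complement, which finitely many small relatively
compact open sets cover. -/
theorem IsRestrictedFromOnePoint.exists_cover_diam_lt [LocallyCompactSpace X]
    (hd : IsRestrictedFromOnePoint X) {ε : ℝ≥0∞} (hε : 0 < ε) :
    ∃ 𝒰 : AdmissibleCover X, 𝒰.diam < ε := by
  classical
  obtain ⟨Y, _, e, hiso⟩ := hd.exists_homeomorph
  obtain ⟨δ, hδ, hδε⟩ : ∃ δ > 0, 2 * δ < ε := by
    obtain ⟨δ, hδ, hδε⟩ := ENNReal.lt_iff_exists_nnreal_btwn.1 hε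
    exact ⟨δ / 2, ENNReal.half_pos hδ.ne', by rwa [ENNReal.mul_div_cancel two_ne_zero (by simp)]⟩
  let B : Set Y := Metric.eball (e OnePoint.infty) δ
  let W : Set X := (fun x : X => e x) ⁻¹' B
  have hW : IsOpen W ∧ IsCompact Wᶜ := by
    have hB : IsOpen (e ⁻¹' B) := Metric.isOpen_eball.preimage e.continuous
    have := (OnePoint.isOpen_iff_of_mem (show OnePoint.infty ∈ e ⁻¹' B from
      Metric.mem_eball_self hδ)).1 hB
    exact ⟨isClosed_compl_iff.1 this.1, this.2⟩
  have hWd : Metric.ediam W ≤ 2 * δ := by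
    rw [← hiso.ediam_image]
    exact (Metric.ediam_mono (Set.image_preimage_subset _ _)).trans Metric.ediam_eball_le
  have hloc : ∀ x : X, ∃ U : Set X, IsAdmissibleOpen U ∧ x ∈ U ∧ Metric.ediam U ≤ 2 * δ := fun x => by
    obtain ⟨K, hK, hxK, hxK'⟩ := local_compact_nhds (Metric.eball_mem_nhds x hδ)
    exact ⟨interior K, ⟨isOpen_interior, Or.inl (hxK'.of_isClosed_subset isClosed_closure
      (hxK'.isClosed.closure_subset_iff.2 interior_subset))⟩, mem_interior_iff_mem_nhds.2 hK,
      (Metric.ediam_mono (interior_subset.trans hxK)).trans Metric.ediam_eball_le⟩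
  choose U hU hxU hUd using hloc
  obtain ⟨t, -, ht⟩ := hW.2.elim_nhds_subcover U fun x _ => (hU x).1.mem_nhds (hxU x)
  refine ⟨⟨insert W (t.image U), ?_, ?_⟩, ?_⟩
  · simp only [Finset.mem_insert, Finset.mem_image, forall_eq_or_imp, forall_exists_index, and_imp,
      forall_apply_eq_imp_iff₂]
    exact ⟨⟨hW.1, Or.inr hW.2⟩, fun x _ => hU x⟩
  · intro x
    by_cases hx : x ∈ W
    · exact ⟨W, Finset.mem_insert_self _ _, hx⟩
    · obtain ⟨y, hy, hxy⟩ := Set.mem_iUnion₂.1 (ht hx)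
      exact ⟨U y, Finset.mem_insert_of_mem (Finset.mem_image_of_mem U hy), hxy⟩
  · refine lt_of_le_of_lt (iSup₂_le ?_) hδε
    simp only [Finset.mem_insert, Finset.mem_image, forall_eq_or_imp, forall_exists_index, and_imp,
      forall_apply_eq_imp_iff₂]
    exact ⟨hWd, fun x _ => hUd x⟩

theorem hasBasis_vanishingDiam :
    (vanishingDiam X).HasBasis (fun δ : ℝ≥0∞ => 0 < δ) fun δ => {𝒰 | 𝒰.diam < δ} :=
  ENNReal.nhds_zero_basis.comap _

theorem AdmissibleCover.ediam_le_diam {𝒰 : AdmissibleCover X} {U : Set X} (hU : U ∈ 𝒰.sets) :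
    Metric.ediam U ≤ 𝒰.diam :=
  le_iSup₂ (f := fun U (_ : U ∈ 𝒰.sets) => Metric.ediam U) U hU

theorem IsRestrictedFromOnePoint.eventually_refines [Nonempty X]
    (hd : IsRestrictedFromOnePoint X) (𝒰 : AdmissibleCover X) :
    ∀ᶠ 𝒱 in vanishingDiam X, ∀ V ∈ 𝒱.sets, ∃ U ∈ 𝒰.sets, V ⊆ U := by
  obtain ⟨δ, hδ, h⟩ := hd.exists_lebesgueNumber 𝒰
  filter_upwards [hasBasis_vanishingDiam.mem_of_mem hδ] with 𝒱 h𝒱 V hV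
  exact h V ((AdmissibleCover.ediam_le_diam hV).trans_lt h𝒱)

theorem eventually_hasOscLE {φ : X → ℝ} (hφ : UniformContinuous φ) {ε : ℝ} (hε : 0 < ε) :
    ∀ᶠ 𝒰 in vanishingDiam X, HasOscLE φ 𝒰 ε := by
  obtain ⟨δ, hδ, h⟩ := EMetric.uniformContinuous_iff.1 hφ (ENNReal.ofReal ε) (by simpa)
  filter_upwards [hasBasis_vanishingDiam.mem_of_mem hδ] with 𝒰 h𝒰 U hU x hx y hy
  have := h (((Metric.edist_le_ediam_of_mem hy hx).trans (AdmissibleCover.ediam_le_diam hU)).trans_lt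
    h𝒰)
  rw [edist_lt_ofReal, Real.dist_eq] at this
  linarith [le_abs_self (φ y - φ x)]

theorem IsRestrictedFromOnePoint.neBot_vanishingDiam [LocallyCompactSpace X]
    (hd : IsRestrictedFromOnePoint X) : (vanishingDiam X).NeBot :=
  hasBasis_vanishingDiam.neBot_iff.2 fun hδ => hd.exists_cover_diam_lt hδ

theorem IsRestrictedFromOnePoint.tendsto_coverPressure [LocallyCompactSpace X] [Nonempty X]
    (hd : IsRestrictedFromOnePoint X) (f : X → X) {φ : X → ℝ} (hφ : UniformContinuous φ)
    (Z : Set X) :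
    Tendsto (coverPressure f φ Z) (vanishingDiam X) (𝓝 (pressure f φ Z)) := by
  have := hd.neBot_vanishingDiam
  refine tendsto_nhds_limUnder (exists_tendsto_of_eventually_le_add fun ε hε => ?_)
  filter_upwards [eventually_hasOscLE hφ hε] with 𝒰 h𝒰
  filter_upwards [hd.eventually_refines 𝒰] with 𝒱 h𝒱
  exact coverPressure_le_of_refines h𝒰 h𝒱

/-- Properness lets `f` extend continuously by fixing `∞`; the Birkhoff sum of the extended data is
the extension. -/
theorem exists_extension_birkhoffSum {f : X → X} (hf : Continuous f)
    (hproper : ∀ K : Set X, IsCompact K → IsCompact (f ⁻¹' K)) {φ : X → ℝ}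
    (hφ : ∃ φ' : C(OnePoint X, ℝ), ∀ x : X, φ' (x : OnePoint X) = φ x) (k : ℕ) :
    ∃ ψ' : C(OnePoint X, ℝ), ∀ x : X, ψ' (x : OnePoint X) = birkhoffSum f φ k x := by
  obtain ⟨φ', hφ'⟩ := hφ
  have hmap : Continuous (OnePoint.map f) := OnePoint.continuous_map hf <| by
    rw [coclosedCompact_eq_cocompact]
    exact (isProperMap_iff_tendsto_cocompact.1 (isProperMap_iff_isCompact_preimage.2 ⟨hf, @hproper⟩)).2
  have hiter : ∀ (j : ℕ) (x : X), (OnePoint.map f)^[j] (x : OnePoint X) = (f^[j] x : X) := fun j x =>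
    ((Function.Semiconj.iterate_right (f := ((↑) : X → OnePoint X)) (ga := f) (gb := OnePoint.map f)
      (fun _ => rfl) j) x).symm
  refine ⟨⟨birkhoffSum (OnePoint.map f) φ' k, ?_⟩, fun x => ?_⟩
  · exact continuous_finsetSum _ fun j _ => φ'.continuous.comp (hmap.iterate j)
  · change birkhoffSum (OnePoint.map f) φ' k x = _
    simp [birkhoffSum, hiter, hφ']

theorem diam_cylinderCover_le {f : X → X} (hf : Continuous f)
    (hproper : ∀ K : Set X, IsCompact K → IsCompact (f ⁻¹' K)) (𝒰 : AdmissibleCover X) {k : ℕ}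
    (hk : 0 < k) : (𝒰.cylinderCover hf hproper k).diam ≤ 𝒰.diam := by
  refine iSup₂_le fun W hW => ?_
  obtain ⟨v, rfl⟩ := (AdmissibleCover.mem_cylinderCover hf hproper).1 hW
  refine (Metric.ediam_mono fun x hx => ?_).trans (AdmissibleCover.ediam_le_diam (v ⟨0, hk⟩).2)
  have := hx 0 (by simpa using hk)
  rwa [List.getElem_ofFn] at this

theorem tendsto_cylinderCover {f : X → X} (hf : Continuous f)
    (hproper : ∀ K : Set X, IsCompact K → IsCompact (f ⁻¹' K)) {k : ℕ} (hk : 0 < k) :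
    Tendsto (fun 𝒰 : AdmissibleCover X => 𝒰.cylinderCover hf hproper k) (vanishingDiam X)
      (vanishingDiam X) :=
  hasBasis_vanishingDiam.tendsto_right_iff.2 fun δ hδ => by
    filter_upwards [hasBasis_vanishingDiam.mem_of_mem hδ] with 𝒰 h𝒰
    exact (diam_cylinderCover_le hf hproper 𝒰 hk).trans_lt h𝒰

end Metric

/-! ### The case `k = 0` -/

section Identity

variable {X : Type*} [TopologicalSpace X]

theorem weight_id_zero {α : ℝ} {𝒰 : AdmissibleCover X} {s : 𝒰.Words} (h : (cylinder id s).Nonempty) :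
    weight id 0 α s = ENNReal.ofReal (Real.exp (-α * s.length)) := by
  have : ⨆ x ∈ cylinder id s, ((birkhoffSum id (0 : X → ℝ) s.length x : ℝ) : EReal) = 0 := by
    have h0 : ∀ x, birkhoffSum id (0 : X → ℝ) s.length x = 0 := fun x => by simp [birkhoffSum]
    simp only [h0, EReal.coe_zero]
    exact biSup_const h
  rw [weight, this, add_zero, EReal.exp_coe]

/-- For `α > 0`, constant words of length `n` cover with total weight at most `card * exp (-α * n)`,
which tends to `0`. For `α < 0`, any single word with nonempty cylinder already weighs at least `1`.
-/
theorem coverPressure_id_zero [Nonempty X] (𝒰 : AdmissibleCover X) :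
    coverPressure id (0 : X → ℝ) Set.univ 𝒰 = 0 := by
  refine le_antisymm ?_ (le_sInf ?_)
  · refine EReal.le_of_forall_pos_real_le_add fun α hα => ?_
    rw [zero_add]
    refine sInf_le ⟨α, le_antisymm (iSup_le fun N => ?_) zero_le, rfl⟩
    have hlim : Tendsto (fun n : ℕ => (𝒰.sets.card : ℝ≥0∞) * ENNReal.ofReal (Real.exp (-α * n))) atTop
        (𝓝 0) := by
      have h₁ : Tendsto (fun n : ℕ => Real.exp (-α * n)) atTop (𝓝 0) :=
        Real.tendsto_exp_atBot.comp
          (tendsto_natCast_atTop_atTop.const_mul_atTop_of_neg (neg_neg_of_pos hα))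
      simpa using ENNReal.Tendsto.const_mul (ENNReal.tendsto_ofReal h₁)
        (Or.inr (ENNReal.natCast_ne_top 𝒰.sets.card))
    refine ge_of_tendsto hlim (eventually_atTop.2 ⟨N, fun n hn => ?_⟩)
    let T : {U : Set X // U ∈ 𝒰.sets} → 𝒰.Words := List.replicate n
    have hT : ∀ U, U.1 ⊆ cylinder id (T U) := fun U x hx j hj => by simpa [T] using hx
    refine iInf_le_of_le (Set.range T ∩ {s | (cylinder id s).Nonempty}) (iInf_le_of_le
      ((Set.countable_range T).mono Set.inter_subset_left) (iInf_le_of_le ?_ (iInf_le_of_le ?_ ?_)))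
    · rintro _ ⟨⟨U, rfl⟩, -⟩
      simpa [T] using hn
    · intro x _
      obtain ⟨U, hU, hx⟩ := 𝒰.covers x
      have hx' := hT ⟨U, hU⟩ hx
      exact Set.mem_iUnion₂.2 ⟨_, ⟨⟨⟨U, hU⟩, rfl⟩, x, hx'⟩, hx'⟩
    · calc
        _ = ∑' s : (Set.range T ∩ {s | (cylinder id s).Nonempty} : Set 𝒰.Words),
            ENNReal.ofReal (Real.exp (-α * n)) := tsum_congr fun s => by
              obtain ⟨U, hU⟩ := s.2.1
              rw [weight_id_zero s.2.2, ← hU]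
              simp [T]
        _ ≤ ∑' s : Set.range T, ENNReal.ofReal (Real.exp (-α * n)) :=
          ENNReal.tsum_mono_subtype (fun _ => ENNReal.ofReal (Real.exp (-α * n))) Set.inter_subset_left
        _ ≤ ∑' U : {U : Set X // U ∈ 𝒰.sets}, ENNReal.ofReal (Real.exp (-α * n)) :=
          ENNReal.tsum_le_tsum_comp_of_surjective Set.rangeFactorization_surjective
            fun _ : Set.range T => ENNReal.ofReal (Real.exp (-α * n))
        _ = _ := by simp [tsum_fintype]
  · rintro _ ⟨α, hα, rfl⟩
    by_contra hlt
    have hα₀ : α < 0 := by simpa using hlt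
    have hα' : outerLimit id (0 : X → ℝ) Set.univ α 𝒰 = 0 := hα
    have h1 : 1 ≤ outerSum id (0 : X → ℝ) Set.univ α 𝒰 0 := by
      refine le_iInf fun G => le_iInf fun _ => le_iInf fun _ => le_iInf fun hG => ?_
      obtain ⟨s, hs, hx⟩ := Set.mem_iUnion₂.1 (hG (Set.mem_univ (Classical.arbitrary X)))
      refine le_trans ?_ (ENNReal.le_tsum (⟨s, hs⟩ : G))
      rw [weight_id_zero ⟨_, hx⟩, ENNReal.one_le_ofReal, Real.one_le_exp_iff]
      exact mul_nonneg (neg_nonneg.2 hα₀.le) (Nat.cast_nonneg _)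
    have := h1.trans ((le_iSup (outerSum id (0 : X → ℝ) Set.univ α 𝒰) 0).trans hα'.le)
    simp at this

end Identity
end AdmissiblePressure

/-! ### The power rule -/

theorem mainTheorem7 {X : Type*} [MetricSpace X] [LocallyCompactSpace X]
    [TopologicalSpace.SeparableSpace X] [Nonempty X]
    (hd : AdmissiblePressure.IsRestrictedFromOnePoint X)
    (f : X → X) (hf : Continuous f) (hproper : ∀ K : Set X, IsCompact K → IsCompact (f ⁻¹' K))
    (φ : C(X, ℝ)) (hφ : ∃ φ' : C(OnePoint X, ℝ), ∀ x : X, φ' (x : OnePoint X) = φ x)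
    (k : ℕ) :
    (AdmissiblePressure.vanishingDiam X).NeBot ∧
    Tendsto (AdmissiblePressure.coverPressure f φ Set.univ) (AdmissiblePressure.vanishingDiam X)
      (𝓝 (AdmissiblePressure.pressure f φ Set.univ)) ∧
    Tendsto (AdmissiblePressure.coverPressure f^[k] (birkhoffSum f φ k) Set.univ)
      (AdmissiblePressure.vanishingDiam X)
      (𝓝 (AdmissiblePressure.pressure f^[k] (birkhoffSum f φ k) Set.univ)) ∧
    AdmissiblePressure.pressure f^[k] (birkhoffSum f φ k) Set.univ =
      (k : EReal) * AdmissiblePressure.pressure f φ Set.univ := by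
  have hbot := hd.neBot_vanishingDiam
  have huc := hd.uniformContinuous hφ
  have hP := hd.tendsto_coverPressure f huc Set.univ
  have hQ := hd.tendsto_coverPressure f^[k]
    (hd.uniformContinuous (AdmissiblePressure.exists_extension_birkhoffSum hf hproper hφ k)) Set.univ
  refine ⟨hbot, hP, hQ, ?_⟩
  -- Cylinders of length `0` are all of `X`, so the comparison by cylinder covers needs `k > 0`.
  rcases Nat.eq_zero_or_pos k with rfl | hk
  · have h0 : AdmissiblePressure.coverPressure f^[0] (birkhoffSum f φ 0) Set.univ =
        fun _ : AdmissiblePressure.AdmissibleCover X => (0 : EReal) :=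
      funext AdmissiblePressure.coverPressure_id_zero
    rw [h0] at hQ
    rw [tendsto_nhds_unique hQ tendsto_const_nhds]
    simp
  have hk' : (0 : ℝ) < k := by exact_mod_cast hk
  -- The limit for `f^[k]` is already known to exist, so it may be computed along cylinder covers
  -- alone.
  have hQ' := hQ.comp (AdmissiblePressure.tendsto_cylinderCover hf hproper hk)
  obtain ⟨B, hB⟩ : ∃ B, ∀ x, |φ x| ≤ B := by
    obtain ⟨φ', hφ'⟩ := hφ
    obtain ⟨B, hB⟩ := isCompact_univ.exists_bound_of_continuousOn φ'.continuous.continuousOn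
    exact ⟨B, fun x => hφ' x ▸ hB x (Set.mem_univ _)⟩
  have hB₀ : 0 ≤ B := (abs_nonneg _).trans (hB (Classical.arbitrary X))
  have hle : AdmissiblePressure.pressure f^[k] (birkhoffSum f φ k) Set.univ ≤
      ((k : ℝ) : EReal) * AdmissiblePressure.pressure f φ Set.univ := by
    refine EReal.le_of_forall_pos_real_le_add fun ε hε => ?_
    -- Oscillation `ε / k` is required because a block sums `k` values of `φ`.
    have hεk : (k : ℝ) * (ε / k) = ε := by field_simp
    refine le_of_tendsto_of_tendsto hQ'
      (((EReal.continuous_const_mul_add_const hk' ε).tendsto _).comp hP) ?_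
    filter_upwards [AdmissiblePressure.eventually_hasOscLE huc (div_pos hε hk')] with 𝒰 h𝒰
    have := AdmissiblePressure.coverPressure_iterate_le hf hproper (Z := Set.univ) h𝒰 hB hB₀ hk
    rwa [hεk] at this
  have hge : AdmissiblePressure.pressure f φ Set.univ ≤ (((k : ℝ)⁻¹ : ℝ) : EReal) *
      AdmissiblePressure.pressure f^[k] (birkhoffSum f φ k) Set.univ := by
    refine EReal.le_of_forall_pos_real_le_add fun ε hε => ?_
    refine le_of_tendsto_of_tendsto hP
      (((EReal.continuous_const_mul_add_const (inv_pos.2 hk') ε).tendsto _).comp hQ') ?_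
    filter_upwards [AdmissiblePressure.eventually_hasOscLE huc hε] with 𝒰 h𝒰
    exact AdmissiblePressure.coverPressure_le_iterate hf hproper h𝒰 hk
  refine le_antisymm hle ?_
  calc
    (k : EReal) * AdmissiblePressure.pressure f φ Set.univ
        ≤ ((k : ℝ) : EReal) * ((((k : ℝ)⁻¹ : ℝ) : EReal) *
          AdmissiblePressure.pressure f^[k] (birkhoffSum f φ k) Set.univ) :=
      mul_le_mul_of_nonneg_left hge (by exact_mod_cast hk'.le)
    _ = _ := by
      rw [← mul_assoc, ← EReal.coe_mul, mul_inv_cancel₀ hk'.ne', EReal.coe_one, one_mul]
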